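/- For a group $G$, let $\underline{\mathcal O}G$ be the orbit category of $G$ over the family of finite subgroups: its objects are the $G$-sets $G/K$ with $K\le G$ finite, its morphisms are the $G$-maps. Consider the abelian category of contravariant functors $M:\underline{\mathcal O}G\to\mathfrak{Ab}$ with natural transformations as morphisms, let $\underline{\mathbb Z}$ be the constant functor with value $\mathbb Z$, and let $\mathrm H^n(G,M)=\mathrm{Ext}^n(\underline{\mathbb Z},M)$, computed in this category, be the $n$-th Bredon cohomology of $G$ with coefficients in $M$. Let $\underline{cd}(G)\in\mathbb N\cup\{\infty\}$ be the Bredon cohomological dimension of $G$ for the family of finite subgroups, i.e. the supremum of all $n\ge 0$ such that $\mathrm H^n(G,M)\ne 0$ for some $M$. Let $1\to H\to G\xrightarrow{\pi}Q\to 1$ be a short exact sequence of groups, let $d\ge 0$ be an integer, and suppose that $\underline{cd}(\pi^{-1}(F))\le d$ for every finite subgroup $F\le Q$. Then $$\underline{cd}(G)\le d+\underline{cd}(Q),$$ where the right-hand side is read as $\infty$ if $\underline{cd}(Q)=\infty$. -/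

import Mathlib

open CategoryTheory

universe u

/-- The orbit category of a group `G` over a collection `F` of subgroups of `G`: its objects are
the transitive `G`-sets `G ⧸ K` for `K ∈ F`, its morphisms are the `G`-equivariant maps. -/
structure OrbitCategory (G : Type u) [Group G] (F : Set (Subgroup G)) where
  /-- The subgroup `K`, which represents the orbit `G ⧸ K`. -/
  subgroup : Subgroup G
  mem : subgroup ∈ F

namespace OrbitCategory

variable {G : Type u} [Group G] {F : Set (Subgroup G)}

instance : SmallCategory (OrbitCategory G F) where
  Hom X Y := (G ⧸ X.subgroup) →[G] (G ⧸ Y.subgroup)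
  id X := MulActionHom.id G
  comp f g := g.comp f

end OrbitCategory

/-- Right modules over the orbit category: contravariant functors to abelian groups, with the
natural transformations as morphisms. -/
abbrev BredonModule (G : Type u) [Group G] (F : Set (Subgroup G)) :=
  (OrbitCategory G F)ᵒᵖ ⥤ AddCommGrpCat.{u}

namespace Bredon

/-- The trivial module: the constant functor with value `ℤ`. -/
noncomputable def trivialModule (G : Type u) [Group G] (F : Set (Subgroup G)) :
    BredonModule G F :=
  (Functor.const _).obj (AddCommGrpCat.of (ULift.{u} ℤ))

/-- The `n`-th Bredon cohomology group of `G` with respect to `F`, with coefficients in `M`: the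
Ext group from the trivial module to `M` in the abelian category of modules over the orbit
category. -/
abbrev cohomology (G : Type u) [Group G] (F : Set (Subgroup G)) (M : BredonModule G F) (n : ℕ) :
    Type (u + 1) :=
  letI := HasExt.standard (BredonModule G F)
  Abelian.Ext.{u + 1} (trivialModule G F) M n

/-- The Bredon cohomological dimension of `G` with respect to `F`: the supremum in `ℕ∞` of the
degrees `n` in which the Bredon cohomology of `G` is nonzero for some coefficient module. -/
noncomputable def cd (G : Type u) [Group G] (F : Set (Subgroup G)) : ℕ∞ :=
  ⨆ (n : ℕ) (_ : ∃ M : BredonModule G F, Nontrivial (cohomology G F M n)), (n : ℕ∞)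

/-- The family of all finite subgroups of `G`. -/
def finiteSubgroups (G : Type u) [Group G] : Set (Subgroup G) := {K | Finite K}

/-- The Bredon cohomological dimension of `G` with respect to the family of finite subgroups. -/
noncomputable def properCd (G : Type u) [Group G] : ℕ∞ := cd G (finiteSubgroups G)

end Bredon

/-! ### Projective dimension under exact functors and coproducts. -/

namespace CategoryTheory

open Limits Opposite

/-! By `cd_le_iff`, both dimensions are projective dimensions of trivial modules. Restriction along
`G/K ↦ Q/π(K)` is exact and takes the trivial module of `Q` to that of `G`, so by
`hasProjectiveDimensionLT_obj_of_exact` (dimension shifting) it is enough that every `Q`-module is a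
quotient of a projective one whose restriction has projective dimension at most `d`.

Coproducts of free modules `ℤ[-, Q/F]` serve. The restriction of such a free module is `K ↦
ℤ[Hom_Q(Q/π(K), Q/F)]`, the constant module `ℤ` on the category of pairs `(G/K, Q/π(K) → Q/F)`,
summed over the maps. That category is equivalent to the orbit category of `π⁻¹(F)`
(`comapFunctor_isEquivalence`), so the restriction is induced from the trivial module of `π⁻¹(F)`.
Induction is exact, as coproducts of abelian groups are, and preserves projectives, as its right
adjoint is exact; hence the bound `d` carries over
(`hasProjectiveDimensionLT_restriction_freeYoneda`). -/

lemma Projective.sigma {C : Type*} [Category* C] {β : Type*} (g : β → C) [HasCoproduct g]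
    (h : ∀ b, Projective (g b)) : Projective (∐ g) where
  factors f e _ :=
    ⟨Limits.Sigma.desc fun b ↦ Projective.factorThru (Limits.Sigma.ι g b ≫ f) e, by cat_disch⟩

section ProjectiveDimension

universe w v v' u₁ u'

variable {C : Type u₁} [Category.{v} C] [Abelian C] {D : Type u'} [Category.{v'} D] [Abelian D]

lemma Projective.hasProjectiveDimensionLT_one (P : C) (hP : Projective P) :
    HasProjectiveDimensionLT P 1 := inferInstance

/-- If `F` is an exact functor such that every object is covered by a projective object whose
image under `F` has projective dimension at most `d`, then `F` raises projective dimensions by at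
most `d`. -/
lemma hasProjectiveDimensionLT_obj_of_exact (F : C ⥤ D) [F.Additive] [PreservesFiniteLimits F]
    [PreservesFiniteColimits F] (d : ℕ)
    (hF : ∀ X : C, ∃ (P : C) (p : P ⟶ X), Epi p ∧ Projective P ∧
      HasProjectiveDimensionLT (F.obj P) (d + 1)) (n : ℕ) (X : C)
    (hX : HasProjectiveDimensionLT X (n + 1)) :
    HasProjectiveDimensionLT (F.obj X) (d + n + 1) := by
  induction n generalizing X with
  | zero =>
    obtain ⟨P, p, _, hP, hd⟩ := hF X
    have : Projective X := projective_iff_hasProjectiveDimensionLT_one.2 hX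
    let r : Retract X P := ⟨Projective.factorThru (𝟙 X) p, p, by simp⟩
    exact (r.map F).hasProjectiveDimensionLT (d + 1)
  | succ n ih =>
    obtain ⟨P, p, _, hP, hd⟩ := hF X
    have h : (ShortComplex.mk _ _ (kernel.condition p)).ShortExact :=
      { exact := ShortComplex.exact_kernel p }
    have hK : HasProjectiveDimensionLT (kernel p) (n + 1) :=
      (h.hasProjectiveDimensionLT_X₃_iff n hP).1 hX
    -- The image of the kernel has dimension at most `d + n` and that of `P` at most `d`, so the
    -- quotient gains at most one over `d + n`.
    exact (h.map_of_exact F).hasProjectiveDimensionLT_X₃ (d + n + 1) (ih _ hK)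
      (hasProjectiveDimensionLT_of_ge (F.obj P) (d + 1) _ (by omega))

/-- An exact functor that preserves projective objects does not raise projective dimensions. -/
lemma hasProjectiveDimensionLT_obj_of_preservesProjectiveObjects [EnoughProjectives C]
    (F : C ⥤ D) [F.Additive] [PreservesFiniteLimits F] [PreservesFiniteColimits F]
    [F.PreservesProjectiveObjects] (n : ℕ) (X : C) (hX : HasProjectiveDimensionLT X (n + 1)) :
    HasProjectiveDimensionLT (F.obj X) (n + 1) := by
  have := hasProjectiveDimensionLT_obj_of_exact F 0
    (fun Y ↦ ⟨Projective.over Y, Projective.π Y, inferInstance, inferInstance,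
      Projective.hasProjectiveDimensionLT_one _ inferInstance⟩) n X hX
  rwa [zero_add] at this

/-- Working with functors on a discrete category lets all syzygies be taken at once, as a kernel of
functors, to which the exact functor `colim` applies. -/
lemma hasProjectiveDimensionLT_colim_discrete [EnoughProjectives C] {ι : Type w}
    [HasColimitsOfShape (Discrete ι) C] [HasExactColimitsOfShape (Discrete ι) C]
    (n : ℕ) (X : Discrete ι ⥤ C) (hX : ∀ j, HasProjectiveDimensionLT (X.obj j) (n + 1)) :
    HasProjectiveDimensionLT (colim.obj X) (n + 1) := by
  induction n generalizing X with
  | zero =>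
    have (j : Discrete ι) : Projective (X.obj j) :=
      projective_iff_hasProjectiveDimensionLT_one.2 (hX j)
    have : Projective (∐ fun i ↦ X.obj ⟨i⟩) := Projective.sigma _ fun i ↦ this ⟨i⟩
    refine Projective.hasProjectiveDimensionLT_one _
      (Projective.of_iso (HasColimit.isoOfNatIso Discrete.natIsoFunctor.symm) this)
  | succ n ih =>
    let P : Discrete ι ⥤ C := Discrete.functor fun i ↦ Projective.over (X.obj ⟨i⟩)
    let p : P ⟶ X := Discrete.natTrans fun i ↦ Projective.π (X.obj i)
    have (j : Discrete ι) : Epi (p.app j) := inferInstanceAs (Epi (Projective.π (X.obj j)))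
    have : Epi p := NatTrans.epi_of_epi_app p
    have hP (j : Discrete ι) : Projective (P.obj j) :=
      inferInstanceAs (Projective (Projective.over (X.obj j)))
    have h : (ShortComplex.mk _ _ (kernel.condition p)).ShortExact :=
      { exact := ShortComplex.exact_kernel p }
    have hK (j : Discrete ι) : HasProjectiveDimensionLT ((kernel p).obj j) (n + 1) :=
      ((h.map_of_exact ((evaluation _ _).obj j)).hasProjectiveDimensionLT_X₃_iff n (hP j)).1 (hX j)
    have hP' : Projective (colim.obj P) := Projective.sigma (fun i ↦ P.obj ⟨i⟩) fun i ↦ hP ⟨i⟩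
    exact (h.map_of_exact colim).hasProjectiveDimensionLT_X₃ (n + 1) (ih _ hK)
      (hasProjectiveDimensionLT_of_ge (colim.obj P) 1 _ (by omega))

/-- In a category with exact coproducts, a coproduct of objects of projective dimension at most `n`
has projective dimension at most `n`. -/
lemma hasProjectiveDimensionLT_sigma [EnoughProjectives C] {ι : Type w}
    [HasColimitsOfShape (Discrete ι) C] [HasExactColimitsOfShape (Discrete ι) C]
    (n : ℕ) (X : ι → C) (hX : ∀ i, HasProjectiveDimensionLT (X i) (n + 1)) :
    HasProjectiveDimensionLT (∐ X) (n + 1) :=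
  hasProjectiveDimensionLT_colim_discrete n (Discrete.functor X) fun j ↦ hX j.as

end ProjectiveDimension

end CategoryTheory

/-! ### Free presheaves of abelian groups and enough projectives. -/

namespace AddCommGrpCat

open Limits

lemma hom_uliftInt_ext {A : AddCommGrpCat.{u}} {f g : of (ULift.{u} ℤ) ⟶ A}
    (h : f.hom ⟨1⟩ = g.hom ⟨1⟩) : f = g := by
  ext x
  obtain ⟨n⟩ := x
  have : (⟨n⟩ : ULift.{u} ℤ) = n • ⟨1⟩ := by ext; simp
  rw [this, map_zsmul, map_zsmul, h]

/-- The homomorphism out of `ℤ` that takes a given value at `1`. -/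
def homOfElement {A : AddCommGrpCat.{u}} (a : A) : of (ULift.{u} ℤ) ⟶ A :=
  ofHom ((zmultiplesHom A a).comp AddEquiv.ulift.toAddMonoidHom)

@[simp]
lemma homOfElement_apply_one {A : AddCommGrpCat.{u}} (a : A) : (homOfElement a).hom ⟨1⟩ = a := by
  change (1 : ℤ) • a = a
  simp

instance projective_uliftInt : Projective (of (ULift.{u} ℤ)) where
  factors {E X} f e _ := by
    obtain ⟨a, ha⟩ := (AddCommGrpCat.epi_iff_surjective e).1 inferInstance (f.hom ⟨1⟩)
    exact ⟨homOfElement a, hom_uliftInt_ext ((congrArg e.hom (homOfElement_apply_one a)).trans ha)⟩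

end AddCommGrpCat

namespace CategoryTheory.Presheaf

open Limits Opposite

variable {C : Type u} [SmallCategory C]

/-- By Yoneda, maps out of `freeYoneda X M` are maps from `M` to the value at `X`, and evaluation at
`X` preserves epimorphisms. -/
instance projective_freeYoneda (X : C) (M : AddCommGrpCat.{u}) [Projective M] :
    Projective (freeYoneda X M) where
  factors {F G} f e _ := by
    refine ⟨freeYonedaHomEquiv.symm (Projective.factorThru (freeYonedaHomEquiv f) (e.app _)), ?_⟩
    rw [freeYonedaHomEquiv_symm_comp, Projective.factorThru_comp, Equiv.symm_apply_apply]

/-- Every presheaf of abelian groups is covered by a coproduct of free presheaves on representable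
ones. -/
lemma exists_epi_sigma_freeYoneda (M : Cᵒᵖ ⥤ AddCommGrpCat.{u}) :
    ∃ (ι : Type u) (c : ι → C)
      (p : ∐ (fun i ↦ freeYoneda (c i) (AddCommGrpCat.of (ULift.{u} ℤ))) ⟶ M), Epi p := by
  let ι := Σ c : C, M.obj (op c)
  let p : ∐ (fun i : ι ↦ freeYoneda i.1 (AddCommGrpCat.of (ULift.{u} ℤ))) ⟶ M :=
    Limits.Sigma.desc fun i : ι ↦ freeYonedaHomEquiv.symm (AddCommGrpCat.homOfElement i.2)
  refine ⟨ι, Sigma.fst, p, ⟨fun {N} f g h ↦ ?_⟩⟩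
  ext ⟨c⟩ a
  -- The summand indexed by `(c, a)` hits `a` as the image of `1`, so the two maps agree at `a`.
  have := congr(freeYonedaHomEquiv (Limits.Sigma.ι
    (fun i : ι ↦ freeYoneda i.1 (AddCommGrpCat.of (ULift.{u} ℤ))) (⟨c, a⟩ : ι) ≫ $h))
  simp only [p, colimit.ι_desc_assoc, Cofan.mk_pt, Cofan.mk_ι_app,
    freeYonedaHomEquiv_symm_comp, Equiv.apply_symm_apply] at this
  have h₁ := AddCommGrpCat.homOfElement_apply_one a
  exact (congrArg (f.app (op c)).hom h₁).symm.trans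
    (congr($(this).hom ⟨1⟩).trans (congrArg (g.app (op c)).hom h₁))

instance enoughProjectives_addCommGrpCat : EnoughProjectives (Cᵒᵖ ⥤ AddCommGrpCat.{u}) where
  presentation M := by
    obtain ⟨ι, c, p, hp⟩ := exists_epi_sigma_freeYoneda M
    exact ⟨{ p := _, projective := Projective.sigma _ fun _ ↦ inferInstance, f := p, epi := hp }⟩

end CategoryTheory.Presheaf

/-! ### Induction from a category of elements: adjunction, exactness, projectives. -/

namespace CategoryTheory

open Limits

universe w v v' u₁ u'

/-- The objects of the category of elements of a functor `X` to types. -/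
structure ElementsOver {C : Type u₁} [Category.{v} C] (X : C ⥤ Type w) where
  /-- The underlying object. -/
  base : C
  /-- The element of the value at the underlying object. -/
  elt : X.obj base

namespace ElementsOver

section

variable {C : Type u₁} [Category.{v} C] {X : C ⥤ Type w}
  {D : Type u'} [Category.{v'} D]

/-- The morphisms of the category of elements of a functor to types. -/
@[ext]
structure Hom (e e' : ElementsOver X) where
  /-- The underlying morphism. -/
  val : e.base ⟶ e'.base
  map_elt : X.map val e.elt = e'.elt

instance : Category (ElementsOver X) where
  Hom := Hom
  id e := ⟨𝟙 e.base, by simp⟩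
  comp f g := ⟨f.val ≫ g.val, by simp [f.map_elt, g.map_elt]⟩

@[ext]
lemma hom_ext {e e' : ElementsOver X} {f g : e ⟶ e'} (h : Hom.val f = Hom.val g) : f = g :=
  Hom.ext h

/-- The morphism of elements given by a morphism and an element of its source. -/
def lift {c c' : C} (f : c ⟶ c') (x : X.obj c) :
    (⟨c, x⟩ : ElementsOver X) ⟶ ⟨c', X.map f x⟩ := ⟨f, rfl⟩

variable (X) in
/-- The projection of the category of elements. -/
@[simps]
def proj : ElementsOver X ⥤ C where
  obj e := e.base
  map f := f.val

variable [HasCoproducts.{w} D]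

/-- Keeping `y` a variable lets `subst` remove the transport between summands whose indices are only
propositionally equal. -/
lemma map_comp_ι_of_eq (A : ElementsOver X ⥤ D) {c c' : C} {x : X.obj c} {y : X.obj c'}
    (f : c ⟶ c') (h : X.map f x = y) :
    A.map (X := ⟨c, x⟩) (Y := ⟨c', y⟩) ⟨f, h⟩ ≫
        Limits.Sigma.ι (fun y : X.obj c' ↦ A.obj ⟨c', y⟩) y =
      A.map (lift f x) ≫ Limits.Sigma.ι (fun y : X.obj c' ↦ A.obj ⟨c', y⟩) (X.map f x) := by
  subst h
  rfl

/-- The coproduct of the values of a functor on the category of elements of `X` over the elements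
of `X.obj c`, as a functor of `c`. -/
noncomputable def sigmaObj (A : ElementsOver X ⥤ D) : C ⥤ D where
  obj c := ∐ fun x : X.obj c ↦ A.obj ⟨c, x⟩
  map {c c'} f := Limits.Sigma.desc fun x ↦
    A.map (lift f x) ≫ Limits.Sigma.ι (fun y : X.obj c' ↦ A.obj ⟨c', y⟩) (X.map f x)
  map_id c := by
    refine Limits.Sigma.hom_ext _ _ fun x ↦ ?_
    rw [Limits.Sigma.ι_desc]
    refine (map_comp_ι_of_eq A (𝟙 c) (y := x) (by simp)).symm.trans ?_
    exact (A.map_id ⟨c, x⟩ =≫ _).trans ((Category.id_comp _).trans (Category.comp_id _).symm)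
  map_comp {c c' c''} f g := by
    refine Limits.Sigma.hom_ext _ _ fun x ↦ ?_
    rw [Limits.Sigma.ι_desc, Limits.Sigma.ι_desc_assoc, Category.assoc, Limits.Sigma.ι_desc,
      ← A.map_comp_assoc]
    exact (map_comp_ι_of_eq A (f ≫ g) (by simp)).symm

/-- The inclusion of a summand of `sigmaObj`. -/
noncomputable def ι (A : ElementsOver X ⥤ D) (e : ElementsOver X) :
    A.obj e ⟶ (sigmaObj A).obj e.base :=
  Limits.Sigma.ι (fun x : X.obj e.base ↦ A.obj ⟨e.base, x⟩) e.elt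

/-- The universal property of the values of `sigmaObj`. -/
noncomputable def desc {A : ElementsOver X ⥤ D} {c : C} {T : D}
    (f : ∀ x : X.obj c, A.obj ⟨c, x⟩ ⟶ T) : (sigmaObj A).obj c ⟶ T :=
  Limits.Sigma.desc f

@[simp]
lemma ι_desc {A : ElementsOver X ⥤ D} {c : C} {T : D}
    (f : ∀ x : X.obj c, A.obj ⟨c, x⟩ ⟶ T) (x : X.obj c) : ι A ⟨c, x⟩ ≫ desc f = f x :=
  Limits.Sigma.ι_desc f x

@[simp]
lemma ι_desc_assoc {A : ElementsOver X ⥤ D} {c : C} {T U : D}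
    (f : ∀ x : X.obj c, A.obj ⟨c, x⟩ ⟶ T) (x : X.obj c) (g : T ⟶ U) :
    ι A ⟨c, x⟩ ≫ desc f ≫ g = f x ≫ g := by
  rw [← Category.assoc, ι_desc]

lemma sigmaObj_hom_ext {A : ElementsOver X ⥤ D} {c : C} {T : D} {f g : (sigmaObj A).obj c ⟶ T}
    (h : ∀ x : X.obj c, ι A ⟨c, x⟩ ≫ f = ι A ⟨c, x⟩ ≫ g) : f = g :=
  Limits.Sigma.hom_ext _ _ h

lemma map_comp_ι (A : ElementsOver X ⥤ D) {e e' : ElementsOver X} (g : e ⟶ e') :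
    A.map g ≫ ι A e' = ι A e ≫ (sigmaObj A).map g.val :=
  (map_comp_ι_of_eq A g.val g.map_elt).trans
    (Limits.Sigma.ι_desc (fun x : X.obj e.base ↦ A.map (lift g.val x) ≫
      Limits.Sigma.ι (fun y : X.obj e'.base ↦ A.obj ⟨e'.base, y⟩) (X.map g.val x)) e.elt).symm

lemma ι_sigmaObj_map (A : ElementsOver X ⥤ D) {c c' : C} (f : c ⟶ c') (x : X.obj c) :
    ι A ⟨c, x⟩ ≫ (sigmaObj A).map f = A.map (lift f x) ≫ ι A ⟨c', X.map f x⟩ :=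
  (map_comp_ι A (lift f x)).symm

/-- The morphism induced on `sigmaObj` by a natural transformation. -/
noncomputable def sigmaMap {A B : ElementsOver X ⥤ D} (φ : A ⟶ B) : sigmaObj A ⟶ sigmaObj B where
  app c := desc fun x ↦ φ.app ⟨c, x⟩ ≫ ι B ⟨c, x⟩
  naturality c c' f := by
    refine sigmaObj_hom_ext fun x ↦ ?_
    rw [ι_desc_assoc, Category.assoc, ι_sigmaObj_map, ← Category.assoc, ι_sigmaObj_map,
      Category.assoc, ι_desc]
    exact φ.naturality_assoc _ _

@[simp]
lemma ι_sigmaMap_app {A B : ElementsOver X ⥤ D} (φ : A ⟶ B) (c : C) (x : X.obj c) :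
    ι A ⟨c, x⟩ ≫ (sigmaMap φ).app c = φ.app ⟨c, x⟩ ≫ ι B ⟨c, x⟩ :=
  ι_desc _ _

@[simp]
lemma ι_sigmaMap_app_assoc {A B : ElementsOver X ⥤ D} (φ : A ⟶ B) (c : C) (x : X.obj c) {T : D}
    (g : (sigmaObj B).obj c ⟶ T) :
    ι A ⟨c, x⟩ ≫ (sigmaMap φ).app c ≫ g = φ.app ⟨c, x⟩ ≫ ι B ⟨c, x⟩ ≫ g :=
  (ι_desc_assoc _ _ _).trans (Category.assoc _ _ _)

lemma sigmaMap_app_eq {A B : ElementsOver X ⥤ D} (φ : A ⟶ B) (c : C) :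
    (sigmaMap φ).app c = Limits.Sigma.map fun x : X.obj c ↦ φ.app ⟨c, x⟩ := by
  refine sigmaObj_hom_ext fun x ↦ ?_
  rw [ι_sigmaMap_app]
  exact (Limits.Sigma.ι_map (fun x : X.obj c ↦ φ.app ⟨c, x⟩) x).symm

variable (X D)

/-- The functor `sigmaObj`, which is left adjoint to the restriction along the projection of the
category of elements. -/
@[simps]
noncomputable def sigma : (ElementsOver X ⥤ D) ⥤ (C ⥤ D) where
  obj A := sigmaObj A
  map φ := sigmaMap φ
  map_id A := by
    ext c
    refine sigmaObj_hom_ext fun x ↦ ?_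
    simp
  map_comp f g := by
    ext c
    refine sigmaObj_hom_ext fun x ↦ ?_
    simp

variable {X D} in
/-- The natural transformations out of `sigmaObj A` are those from `A` to the restriction along the
projection of the category of elements. -/
noncomputable def sigmaObjHomEquiv (A : ElementsOver X ⥤ D) (M : C ⥤ D) :
    (sigmaObj A ⟶ M) ≃ (A ⟶ proj X ⋙ M) where
  toFun f :=
    { app e := ι A e ≫ f.app e.base
      naturality e e' g := by
        refine (Category.assoc _ _ _).symm.trans ((map_comp_ι A g =≫ _).trans ?_)
        refine (Category.assoc _ _ _).trans (Eq.trans ?_ (Category.assoc _ _ _).symm)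
        exact ι A e ≫= f.naturality g.val }
  invFun g :=
    { app c := desc fun x ↦ g.app ⟨c, x⟩
      naturality c c' f := by
        refine sigmaObj_hom_ext fun x ↦ ?_
        rw [← Category.assoc, ι_sigmaObj_map, Category.assoc]
        refine (A.map _ ≫= ι_desc (T := M.obj c') (fun x ↦ g.app ⟨c', x⟩) _).trans ?_
        refine (g.naturality (lift f x)).trans ?_
        exact (ι_desc_assoc (T := M.obj c) (fun x ↦ g.app ⟨c, x⟩) x (M.map f)).symm }
  left_inv f := by
    ext c
    exact sigmaObj_hom_ext fun x ↦ ι_desc _ _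
  right_inv g := by
    ext e
    exact ι_desc _ _

/-- The functor `sigma` is left adjoint to the restriction along the projection of the category of
elements. -/
noncomputable def sigmaAdjunction : sigma X D ⊣ (Functor.whiskeringLeft _ _ D).obj (proj X) :=
  Adjunction.mkOfHomEquiv
    { homEquiv A M := sigmaObjHomEquiv A M
      homEquiv_naturality_left_symm {A B M} f g := by
        ext c
        refine sigmaObj_hom_ext fun x ↦ ?_
        refine (ι_desc _ _).trans (Eq.trans ?_ (ι_sigmaMap_app_assoc f c x _).symm)
        exact f.app ⟨c, x⟩ ≫= (ι_desc (T := M.obj c) (fun x ↦ g.app ⟨c, x⟩) x).symm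
      homEquiv_naturality_right f g := by
        ext e
        exact (Category.assoc _ _ _).symm }

/-- The functor `sigma` takes a constant functor to the corresponding coproducts of copies of its
value. -/
noncomputable def sigmaConstIso (M : D) :
    (sigma X D).obj ((Functor.const _).obj M) ≅ X ⋙ sigmaConst.obj M :=
  NatIso.ofComponents (fun c ↦ Iso.refl (∐ fun _ : X.obj c ↦ M)) (fun {c c'} f ↦ by
    refine (Category.comp_id _).trans (Eq.trans ?_ (Category.id_comp _).symm)
    refine Limits.Sigma.hom_ext _ _ fun x ↦ ?_
    refine (Limits.Sigma.ι_desc _ x).trans (Eq.trans ?_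
      (Limits.Sigma.ι_comp_map' (f := fun _ ↦ M) (g := fun _ ↦ M) (X.map f) (fun _ ↦ 𝟙 M) x).symm)
    rfl)

end

section Abelian

variable {C : Type u} [SmallCategory C] (X : C ⥤ Type u)
  (D : Type u') [Category.{v'} D] [Abelian D] [HasCoproducts.{u} D]

instance : (sigma X D).IsLeftAdjoint := (sigmaAdjunction X D).isLeftAdjoint

instance : (sigma X D).Additive where
  map_add {A B f g} := by
    ext c
    refine sigmaObj_hom_ext fun x ↦ ?_
    refine (ι_sigmaMap_app _ c x).trans (Eq.trans ?_ (Preadditive.comp_add _ _ _ _ _ _).symm)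
    refine (Preadditive.add_comp _ _ _ _ _ _).trans ?_
    exact congrArg₂ (· + ·) (ι_sigmaMap_app f c x).symm (ι_sigmaMap_app g c x).symm

instance : PreservesFiniteColimits (sigma X D) where
  preservesFiniteColimits _ _ _ := inferInstance

instance [AB4OfSize.{u} D] : (sigma X D).PreservesMonomorphisms where
  preserves {A B} φ _ := by
    have (c : C) : Mono (((sigma X D).map φ).app c) := by
      -- At each object the map is a coproduct of monomorphisms, hence mono by AB4.
      have (x : X.obj c) : Mono (φ.app ⟨c, x⟩) := inferInstance
      rw [sigma_map, sigmaMap_app_eq]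
      exact MorphismProperty.colimMap _ (fun ⟨j⟩ ↦ inferInstanceAs (Mono (φ.app ⟨c, j⟩)))
    exact NatTrans.mono_of_mono_app _

instance [AB4OfSize.{u} D] : PreservesFiniteLimits (sigma X D) :=
by
  have h' := (Functor.preservesFiniteLimits_tfae (sigma X D)).out 0 3
  refine h'.1 fun S hS ↦ ⟨?_, ?_⟩
  · have h := (Functor.preservesFiniteColimits_tfae (sigma X D)).out 3 0
    exact (h.1 inferInstance S hS).1
  · have := hS.mono_f
    infer_instance

instance : (sigma X D).PreservesProjectiveObjects :=
  Functor.preservesProjectiveObjects_of_adjunction_of_preservesEpimorphisms (sigmaAdjunction X D)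

end Abelian

end CategoryTheory.ElementsOver

/-! ### Coset spaces and the functor `G/K ↦ Q/π(K)`. -/

namespace OrbitCategory

open Opposite Bredon

section Quotient

variable {G Q : Type*} [Group G] [Group Q]

/-- The `G`-map from `G ⧸ K` that takes the base point to a given `K`-fixed point. -/
def homOfFixed {T : Type*} [MulAction G T] {K : Subgroup G} (t : T) (ht : ∀ k ∈ K, k • t = t) :
    (G ⧸ K) →[G] T where
  toFun x := Quotient.liftOn' x (fun g ↦ g • t) fun a b hab ↦ by
    have h := ht _ (QuotientGroup.leftRel_apply.1 hab)
    rw [mul_smul, inv_smul_eq_iff] at h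
    exact h.symm
  map_smul' g x := by
    induction x using QuotientGroup.induction_on with
    | H a => exact mul_smul g a t

@[simp]
lemma homOfFixed_mk {T : Type*} [MulAction G T] {K : Subgroup G} (t : T)
    (ht : ∀ k ∈ K, k • t = t) (g : G) : homOfFixed t ht (g : G ⧸ K) = g • t := rfl

lemma mulActionHom_ext {T : Type*} [MulAction G T] {K : Subgroup G} {f f' : (G ⧸ K) →[G] T}
    (h : f ((1 : G) : G ⧸ K) = f' ((1 : G) : G ⧸ K)) : f = f' := by
  ext x
  induction x using QuotientGroup.induction_on with
  | H a =>
    have ha : (a : G ⧸ K) = a • ((1 : G) : G ⧸ K) := congrArg _ (mul_one a).symm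
    rw [ha, map_smul, map_smul, h]

lemma smul_mk_one {K : Subgroup G} (k : G) (hk : k ∈ K) :
    k • ((1 : G) : G ⧸ K) = ((1 : G) : G ⧸ K) :=
  (QuotientGroup.eq (s := K)).2 (by simpa using hk)

lemma smul_apply_one {T : Type*} [MulAction G T] {K : Subgroup G} (f : (G ⧸ K) →[G] T) (k : G)
    (hk : k ∈ K) : k • f ((1 : G) : G ⧸ K) = f ((1 : G) : G ⧸ K) := by
  rw [← map_smul, smul_mk_one k hk]

/-- The map on coset spaces induced by a group homomorphism. -/
def mapQuotient (π : G →* Q) (K : Subgroup G) : G ⧸ K → Q ⧸ K.map π :=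
  Quotient.map' π fun a b hab ↦ by
    rw [QuotientGroup.leftRel_apply] at hab ⊢
    exact ⟨_, hab, by simp⟩

@[simp]
lemma mapQuotient_mk (π : G →* Q) (K : Subgroup G) (g : G) :
    mapQuotient π K (g : G ⧸ K) = (π g : Q ⧸ K.map π) := rfl

lemma mapQuotient_smul (π : G →* Q) (K : Subgroup G) (g : G) (x : G ⧸ K) :
    mapQuotient π K (g • x) = π g • mapQuotient π K x := by
  induction x using QuotientGroup.induction_on with
  | H a => exact congrArg _ (map_mul π g a)

lemma mapQuotient_injective (π : G →* Q) (hπ : Function.Injective π) (K : Subgroup G) :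
    Function.Injective (mapQuotient π K) := by
  intro x y h
  induction x using QuotientGroup.induction_on with
  | H a =>
    induction y using QuotientGroup.induction_on with
    | H b =>
      rw [mapQuotient_mk, mapQuotient_mk, QuotientGroup.eq] at h
      obtain ⟨k, hk, hk'⟩ := h
      rw [QuotientGroup.eq]
      have : k = a⁻¹ * b := hπ (by simpa using hk')
      exact this ▸ hk

/-- The equivariant map on coset spaces of the target of a group homomorphism that is induced by an
equivariant map on coset spaces of the source. -/
def mapHom (π : G →* Q) {K L : Subgroup G} (f : (G ⧸ K) →[G] (G ⧸ L)) :
    (Q ⧸ K.map π) →[Q] (Q ⧸ L.map π) :=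
  homOfFixed (mapQuotient π L (f ((1 : G) : G ⧸ K))) (by
    rintro _ ⟨k, hk, rfl⟩
    rw [← mapQuotient_smul, smul_apply_one f k hk])

lemma mapHom_mapQuotient (π : G →* Q) {K L : Subgroup G} (f : (G ⧸ K) →[G] (G ⧸ L)) (x : G ⧸ K) :
    mapHom π f (mapQuotient π K x) = mapQuotient π L (f x) := by
  induction x using QuotientGroup.induction_on with
  | H a =>
    have ha : (a : G ⧸ K) = a • ((1 : G) : G ⧸ K) := congrArg _ (mul_one a).symm
    rw [mapQuotient_mk, mapHom, homOfFixed_mk, ← mapQuotient_smul, ← map_smul, ← ha]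

lemma mapHom_mk_one (π : G →* Q) {K L : Subgroup G} (f : (G ⧸ K) →[G] (G ⧸ L)) :
    mapHom π f ((1 : Q) : Q ⧸ K.map π) = mapQuotient π L (f ((1 : G) : G ⧸ K)) :=
  one_smul _ _

lemma mapHom_id (π : G →* Q) (K : Subgroup G) :
    mapHom π (MulActionHom.id G : (G ⧸ K) →[G] (G ⧸ K)) = MulActionHom.id Q :=
  mulActionHom_ext ((mapHom_mk_one π _).trans (congrArg _ (map_one π)))

end Quotient

variable {G Q : Type u} [Group G] [Group Q]

/-- The functor between orbit categories over the finite subgroups that is induced by a group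
homomorphism. -/
def mapFunctor (π : G →* Q) :
    OrbitCategory G (finiteSubgroups G) ⥤ OrbitCategory Q (finiteSubgroups Q) where
  obj K := ⟨K.subgroup.map π, by
    have : Finite K.subgroup := K.mem
    exact ((K.subgroup : Set G).toFinite.image π).to_subtype⟩
  map f := mapHom π f
  map_id K := mapHom_id π K.subgroup
  map_comp {K L M} f g := mulActionHom_ext <| by
    refine (mapHom_mk_one π (MulActionHom.comp g f)).trans ?_
    refine Eq.trans ?_ (congrArg (mapHom π g) (mapHom_mk_one π f).symm)
    exact (mapHom_mapQuotient π g _).symm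

end OrbitCategory

/-! ### Orbits of `G` lying over `Q/F` and orbits of `π⁻¹(F)`. -/

namespace OrbitCategory

open Opposite Bredon

section

variable {G Q : Type*} [Group G] [Group Q] (π : G →* Q) (F : Subgroup Q)

/-- The map from the image of an orbit of the preimage of a subgroup that preserves base points. -/
def baseHom (K : Subgroup (F.comap π)) :
    (Q ⧸ (K.map (F.comap π).subtype).map π) →[Q] (Q ⧸ F) :=
  homOfFixed ((1 : Q) : Q ⧸ F) (by
    rintro _ ⟨_, ⟨s, -, rfl⟩, rfl⟩
    exact smul_mk_one _ s.2)

lemma baseHom_mapQuotient_mapQuotient (K : Subgroup (F.comap π)) (x : F.comap π ⧸ K) :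
    baseHom π F K (mapQuotient π _ (mapQuotient (F.comap π).subtype K x)) =
      ((1 : Q) : Q ⧸ F) := by
  induction x using QuotientGroup.induction_on with
  | H s => exact smul_mk_one (π s.1) s.2

lemma baseHom_mk_one (K : Subgroup (F.comap π)) :
    baseHom π F K ((1 : Q) : Q ⧸ (K.map (F.comap π).subtype).map π) = ((1 : Q) : Q ⧸ F) :=
  one_smul _ _

lemma baseHom_comp_mapHom {K L : Subgroup (F.comap π)}
    (f : (F.comap π ⧸ K) →[F.comap π] (F.comap π ⧸ L)) :
    (baseHom π F L).comp (mapHom π (mapHom (F.comap π).subtype f)) = baseHom π F K := by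
  refine mulActionHom_ext ?_
  rw [baseHom_mk_one, MulActionHom.comp_apply, mapHom_mk_one, mapHom_mk_one]
  exact baseHom_mapQuotient_mapQuotient π F L _

lemma mapHom_subtype_injective {G : Type*} [Group G] (S : Subgroup G) {K L : Subgroup S} :
    Function.Injective (mapHom S.subtype : ((S ⧸ K) →[S] (S ⧸ L)) → _) := by
  intro f f' h
  refine mulActionHom_ext (mapQuotient_injective S.subtype Subtype.val_injective L ?_)
  rw [← mapHom_mk_one, ← mapHom_mk_one, h]

/-- A map between orbits of `G` that is compatible with the base points of an orbit of `Q` comes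
from a map between orbits of the preimage. -/
lemma exists_mapHom_subtype_eq {K L : Subgroup (F.comap π)}
    (h : (G ⧸ K.map (F.comap π).subtype) →[G] (G ⧸ L.map (F.comap π).subtype))
    (hh : (baseHom π F L).comp (mapHom π h) = baseHom π F K) :
    ∃ f : (F.comap π ⧸ K) →[F.comap π] (F.comap π ⧸ L), mapHom (F.comap π).subtype f = h := by
  obtain ⟨g, hg⟩ := QuotientGroup.mk_surjective (h ((1 : G) : G ⧸ _))
  -- Compatibility with the base points says `π(g)F = F`.
  have hgS : g ∈ F.comap π := by
    have h₁ := congrArg (fun f ↦ f ((1 : Q) : Q ⧸ _)) hh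
    simp only [MulActionHom.comp_apply, mapHom_mk_one, ← hg, mapQuotient_mk, baseHom_mk_one] at h₁
    have h₂ : ((π g * 1 : Q) : Q ⧸ F) = ((1 : Q) : Q ⧸ F) := h₁
    rw [mul_one, eq_comm, QuotientGroup.eq, inv_one, one_mul] at h₂
    exact h₂
  let t : F.comap π ⧸ L := ((⟨g, hgS⟩ : F.comap π) : F.comap π ⧸ L)
  have ht : mapQuotient (F.comap π).subtype L t = h ((1 : G) : G ⧸ _) := hg
  refine ⟨homOfFixed t fun l hl ↦
    mapQuotient_injective (F.comap π).subtype Subtype.val_injective _ ?_, mulActionHom_ext ?_⟩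
  · rw [mapQuotient_smul, ht]
    exact smul_apply_one h _ ⟨l, hl, rfl⟩
  · rw [mapHom_mk_one, homOfFixed_mk, one_smul, ht]

/-- Every orbit of `G` whose image maps to an orbit of `Q` comes from an orbit of the preimage. -/
lemma exists_comap_orbit (hπ : Function.Surjective π) (K : Subgroup G) [Finite K]
    (φ : (Q ⧸ K.map π) →[Q] (Q ⧸ F)) :
    ∃ (K' : Subgroup (F.comap π)) (_ : Finite K')
      (a : (G ⧸ K) →[G] (G ⧸ K'.map (F.comap π).subtype))
      (b : (G ⧸ K'.map (F.comap π).subtype) →[G] (G ⧸ K)),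
      b.comp a = MulActionHom.id G ∧ a.comp b = MulActionHom.id G ∧
        (baseHom π F K').comp (mapHom π a) = φ ∧ φ.comp (mapHom π b) = baseHom π F K' := by
  obtain ⟨q, hq⟩ := QuotientGroup.mk_surjective (φ ((1 : Q) : Q ⧸ _))
  obtain ⟨g, rfl⟩ := hπ q
  -- With `φ` sending the base point to `π(g)F`, the orbit sought is that of `K' = g⁻¹Kg`; `a` and
  -- `b` are right translations by `g` and `g⁻¹`.
  let c : F.comap π →* G := (MulAut.conj g).toMonoidHom.comp (F.comap π).subtype
  have hc : Function.Injective c := (MulAut.conj g).injective.comp Subtype.val_injective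
  let K' : Subgroup (F.comap π) := K.comap c
  have hK' : Finite K' := ((K : Set G).toFinite.preimage hc.injOn).to_subtype
  -- `π(K)` fixes `π(g)F`, so all of `g⁻¹Kg` lies in `π⁻¹(F)` and `K'` loses nothing.
  have hS (k : G) (hk : k ∈ K) : g⁻¹ * k * g ∈ F.comap π := by
    have h := smul_apply_one φ (π k) ⟨k, hk, rfl⟩
    rw [← hq] at h
    have h' := (QuotientGroup.eq (s := F)).1 h.symm
    simpa [mul_assoc] using h'
  let a : (G ⧸ K) →[G] (G ⧸ K'.map (F.comap π).subtype) :=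
    homOfFixed ((g : G) : G ⧸ K'.map (F.comap π).subtype) fun k hk ↦ by
      refine ((QuotientGroup.eq).2 ?_).symm
      refine ⟨⟨g⁻¹ * k * g, hS k hk⟩, ?_, ?_⟩
      · change g * (g⁻¹ * k * g) * g⁻¹ ∈ K
        simpa [mul_assoc] using hk
      · simp [mul_assoc]
  let b : (G ⧸ K'.map (F.comap π).subtype) →[G] (G ⧸ K) :=
    homOfFixed ((g⁻¹ : G) : G ⧸ K) (by
      rintro _ ⟨k, hk, rfl⟩
      refine ((QuotientGroup.eq).2 ?_).symm
      have : g * (k : G) * g⁻¹ ∈ K := hk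
      simpa [mul_assoc] using this)
  have hab : b.comp a = MulActionHom.id G := mulActionHom_ext <| by
    change ((1 : G) * g) • ((g⁻¹ : G) : G ⧸ K) = ((1 : G) : G ⧸ K)
    rw [one_mul]
    exact congrArg _ (mul_inv_cancel g)
  have hba : a.comp b = MulActionHom.id G := mulActionHom_ext <| by
    change ((1 : G) * g⁻¹) • (g : G ⧸ K'.map (F.comap π).subtype) = ((1 : G) : G ⧸ _)
    rw [one_mul]
    exact congrArg _ (inv_mul_cancel g)
  refine ⟨K', hK', a, b, hab, hba, mulActionHom_ext ?_, mulActionHom_ext ?_⟩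
  · rw [MulActionHom.comp_apply, mapHom_mk_one, ← hq]
    change π ((1 : G) * g) • ((1 : Q) : Q ⧸ F) = _
    rw [one_mul]
    exact congrArg _ (mul_one (π g))
  · rw [MulActionHom.comp_apply, mapHom_mk_one, baseHom_mk_one]
    have : mapQuotient π K (b ((1 : G) : G ⧸ _)) = (π g)⁻¹ • ((1 : Q) : Q ⧸ K.map π) := by
      rw [← map_inv]
      change mapQuotient π K ((((1 : G) * g⁻¹ : G)) : G ⧸ K) = _
      rw [one_mul, mapQuotient_mk]
      exact congrArg _ (mul_one _).symm
    rw [this, map_smul, ← hq]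
    exact congrArg _ (inv_mul_cancel (π g))

end

end OrbitCategory

/-! ### The equivalence of the orbit category of `π⁻¹(F)` with the category of elements. -/

namespace OrbitCategory

open Opposite Bredon

variable {G Q : Type u} [Group G] [Group Q] (π : G →* Q) (F : OrbitCategory Q (finiteSubgroups Q))

/-- The presheaf of maps from the images of orbits to a fixed orbit. -/
abbrev mapsTo : (OrbitCategory G (finiteSubgroups G))ᵒᵖ ⥤ Type u :=
  (mapFunctor π).op ⋙ yoneda.obj F

/-- The orbits of the preimage of a subgroup `F` as orbits of `G` with a map to the orbit of `F`. -/
def comapFunctor :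
    (OrbitCategory (F.subgroup.comap π) (finiteSubgroups (F.subgroup.comap π)))ᵒᵖ ⥤
      ElementsOver (mapsTo π F) where
  obj K := ⟨op ((mapFunctor (F.subgroup.comap π).subtype).obj K.unop),
    baseHom π F.subgroup K.unop.subgroup⟩
  map f := ⟨((mapFunctor (F.subgroup.comap π).subtype).map f.unop).op,
    baseHom_comp_mapHom π F.subgroup f.unop⟩
  map_id K := ElementsOver.hom_ext
    (congrArg Quiver.Hom.op ((mapFunctor (F.subgroup.comap π).subtype).map_id K.unop))
  map_comp f g := ElementsOver.hom_ext
    (congrArg Quiver.Hom.op ((mapFunctor (F.subgroup.comap π).subtype).map_comp g.unop f.unop))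

instance : (comapFunctor π F).Faithful where
  map_injective {K L} f f' h := by
    have h' := congrArg ElementsOver.Hom.val h
    exact Quiver.Hom.unop_inj (mapHom_subtype_injective _ (Quiver.Hom.op_inj h'))

instance : (comapFunctor π F).Full where
  map_surjective {K L} f := by
    obtain ⟨f', hf'⟩ := exists_mapHom_subtype_eq π F.subgroup f.val.unop f.map_elt
    exact ⟨Quiver.Hom.op f', ElementsOver.hom_ext (Quiver.Hom.unop_inj hf')⟩

lemma comapFunctor_essSurj (hπ : Function.Surjective π) : (comapFunctor π F).EssSurj where
  mem_essImage e := by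
    obtain ⟨⟨K⟩, φ⟩ := e
    have : Finite K.subgroup := K.mem
    obtain ⟨K', hK', a, b, hab, hba, hφ, hφ'⟩ :=
      exists_comap_orbit π F.subgroup hπ K.subgroup φ
    let K'' : OrbitCategory _ (finiteSubgroups (F.subgroup.comap π)) := ⟨K', hK'⟩
    let a' : K ⟶ (mapFunctor (F.subgroup.comap π).subtype).obj K'' := a
    let b' : (mapFunctor (F.subgroup.comap π).subtype).obj K'' ⟶ K := b
    exact ⟨op K'', ⟨{
      hom := ⟨a'.op, hφ⟩
      inv := ⟨b'.op, hφ'⟩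
      hom_inv_id := ElementsOver.hom_ext (congrArg Quiver.Hom.op hba)
      inv_hom_id := ElementsOver.hom_ext (congrArg Quiver.Hom.op hab) }⟩⟩

lemma comapFunctor_isEquivalence (hπ : Function.Surjective π) :
    (comapFunctor π F).IsEquivalence where
  essSurj := comapFunctor_essSurj π F hπ

end OrbitCategory

/-! ### Bredon dimension as projective dimension, and the restriction of free modules. -/

namespace Bredon

open Limits Opposite OrbitCategory

lemma cd_le_iff (G : Type u) [Group G] (F : Set (Subgroup G)) (n : ℕ) :
    cd G F ≤ n ↔ HasProjectiveDimensionLT (trivialModule G F) (n + 1) := by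
  let := HasExt.standard (BredonModule G F)
  rw [cd, iSup₂_le_iff]
  constructor
  · intro h
    refine HasProjectiveDimensionLT.mk fun i hi M e ↦ ?_
    by_contra he
    have := h i ⟨M, ⟨e, 0, he⟩⟩
    have : i ≤ n := by exact_mod_cast this
    omega
  · rintro h i ⟨M, hM⟩
    by_contra hi
    have hi : n < i := by
      have := not_le.1 hi
      exact_mod_cast this
    have := HasProjectiveDimensionLT.subsingleton (trivialModule G F) (n + 1) i hi M
    exact not_nontrivial _ hM

variable {G Q : Type u} [Group G] [Group Q] (π : G →* Q)

/-- The restriction of modules along the functor between orbit categories induced by a group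
homomorphism. -/
noncomputable abbrev restriction :
    BredonModule Q (finiteSubgroups Q) ⥤ BredonModule G (finiteSubgroups G) :=
  (Functor.whiskeringLeft _ _ _).obj (mapFunctor π).op

instance additive_whiskeringLeft_obj {C D E : Type*} [Category* C] [Category* D] [Category* E]
    [Preadditive E] (F : C ⥤ D) : ((Functor.whiskeringLeft C D E).obj F).Additive where

/-- The restriction of a free module on an orbit of a finite subgroup `F` is induced from the trivial
module of the preimage of `F`. -/
lemma hasProjectiveDimensionLT_restriction_freeYoneda (hπ : Function.Surjective π)
    (F : OrbitCategory Q (finiteSubgroups Q)) (n : ℕ)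
    (h : properCd (F.subgroup.comap π) ≤ n) :
    HasProjectiveDimensionLT
      ((restriction π).obj (Presheaf.freeYoneda F (AddCommGrpCat.of (ULift.{u} ℤ)))) (n + 1) := by
  have := comapFunctor_isEquivalence π F hπ
  let e := (comapFunctor π F).asEquivalence
  let E : BredonModule (F.subgroup.comap π) (finiteSubgroups _) ⥤
      (ElementsOver (mapsTo π F) ⥤ AddCommGrpCat.{u}) :=
    (Functor.whiskeringLeft _ _ _).obj e.inverse
  have : E.IsEquivalence :=
    inferInstanceAs (e.congrLeft (E := AddCommGrpCat.{u})).functor.IsEquivalence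
  let L := E ⋙ ElementsOver.sigma (mapsTo π F) AddCommGrpCat.{u}
  have : PreservesFiniteLimits E := ⟨fun _ ↦ inferInstance⟩
  have : PreservesFiniteColimits E := ⟨fun _ ↦ inferInstance⟩
  have : PreservesFiniteLimits L := comp_preservesFiniteLimits _ _
  have : PreservesFiniteColimits L := comp_preservesFiniteColimits _ _
  have hL := hasProjectiveDimensionLT_obj_of_preservesProjectiveObjects L n _
    ((cd_le_iff _ _ n).1 h)
  -- Precomposing a constant functor with `e.inverse` gives a constant functor definitionally, so
  -- `sigmaConstIso` applies as it stands.
  let i : L.obj (trivialModule _ _) ≅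
      (restriction π).obj (Presheaf.freeYoneda F (AddCommGrpCat.of (ULift.{u} ℤ))) :=
    ElementsOver.sigmaConstIso (mapsTo π F) AddCommGrpCat.{u} (AddCommGrpCat.of (ULift.{u} ℤ))
  exact hasProjectiveDimensionLT_of_iso i (n + 1)

/-- Restriction preserves coproducts, so the bound for free modules on single orbits extends to
their coproducts, which cover every module. -/
lemma exists_epi_projective_restriction (hπ : Function.Surjective π) (d : ℕ)
    (hd : ∀ F : Subgroup Q, Finite F → properCd (F.comap π) ≤ d)
    (M : BredonModule Q (finiteSubgroups Q)) :
    ∃ (P : BredonModule Q (finiteSubgroups Q)) (p : P ⟶ M), Epi p ∧ Projective P ∧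
      HasProjectiveDimensionLT ((restriction π).obj P) (d + 1) := by
  obtain ⟨ι, c, p, hp⟩ := Presheaf.exists_epi_sigma_freeYoneda M
  refine ⟨_, p, hp, Projective.sigma _ fun i ↦ inferInstance, ?_⟩
  have := hasProjectiveDimensionLT_sigma d
    (fun i ↦ (restriction π).obj (Presheaf.freeYoneda (c i) (AddCommGrpCat.of (ULift.{u} ℤ))))
    fun i ↦ hasProjectiveDimensionLT_restriction_freeYoneda π hπ (c i) d (hd _ (c i).mem)
  exact hasProjectiveDimensionLT_of_iso (PreservesCoproduct.iso (restriction π) _).symm (d + 1)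

end Bredon

theorem corollary4p4 {H G Q : Type u} [Group H] [Group G] [Group Q]
    (i : H →* G) (π : G →* Q) (hi : Function.Injective i) (hexact : i.range = π.ker)
    (hπ : Function.Surjective π) (d : ℕ)
    (hd : ∀ F : Subgroup Q, Finite F → Bredon.properCd (F.comap π) ≤ d) :
    Bredon.properCd G ≤ d + Bredon.properCd Q := by
  by_cases hQ : Bredon.properCd Q = ⊤
  · simp [hQ]
  · obtain ⟨k, hk⟩ := ENat.ne_top_iff_exists.1 hQ
    have hZ := (Bredon.cd_le_iff _ _ k).1 hk.ge
    have : Limits.PreservesFiniteLimits (Bredon.restriction π) := ⟨fun _ ↦ inferInstance⟩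
    have : Limits.PreservesFiniteColimits (Bredon.restriction π) := ⟨fun _ ↦ inferInstance⟩
    have h := hasProjectiveDimensionLT_obj_of_exact (Bredon.restriction π) d
      (Bredon.exists_epi_projective_restriction π hπ d hd) k _ hZ
    rw [← hk, ← Nat.cast_add]
    -- The restriction of the trivial module of `Q` is definitionally the trivial module of `G`.
    exact (Bredon.cd_le_iff _ _ (d + k)).2 h
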